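/- Let $n,N,M\ge 0$ be integers, let $\Omega\subset\mathbb R^n$ be open, and let $A(a)$, $a\in\Omega$, be a family of complex $N\times N$ matrices which is uniformly strongly hyperbolic: for every $a\in\Omega$ all eigenvalues of $A(a)$ are real and semisimple, and there is a constant $C$ such that $|\Pi_\lambda(a)|\le C$ for all $a\in\Omega$ and all $\lambda$ in the spectrum $\Sigma(a)$ of $A(a)$, where $\Pi_\lambda(a)$ is the eigenprojector of $A(a)$ for $\lambda$, i.e. the projector onto $\ker(A(a)-\lambda\,\mathrm{Id})$ along the range of $A(a)-\lambda\,\mathrm{Id}$. Let $S(\lambda,a)$, $(\lambda,a)\in\mathbb R\times\Omega$, take values in the complex $M\times N$ matrices (row vectors being the case $M=1$; a scalar function $f$ is included as $S=f\,\mathrm{Id}$, $M=N$), and put $$S_A(a)=\sum_{\lambda\in\Sigma(a)}S(\lambda,a)\,\Pi_\lambda(a),\qquad a\in\Omega .$$ If $A$ is continuous [resp. $W^{1,\infty}$] [resp. $C^\infty$] on $\Omega$ and $S$ is continuous [resp. $W^{1,\infty}$] [resp. $C^\infty$] on $\mathbb R\times\Omega$, then $S_A$ is continuous [resp. $W^{1,\infty}$]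 [resp. $C^\infty$] on $\Omega$. Here $W^{1,\infty}(U)$, for an open set $U$, is the space of bounded functions on $U$ whose weak (distributional) gradient belongs to $L^\infty(U)$; its elements are identified with their continuous representatives, so that their pointwise values make sense. -/

import Mathlib

open MeasureTheory
-- `Matrix` carries the operator norm for the Euclidean norms on `ℂ^M`, `ℂ^N`.
open scoped Matrix.Norms.L2Operator ContDiff ENNReal

noncomputable section

namespace StrongHyp

section Sobolev

variable {X F : Type*} [NormedAddCommGroup X] [NormedSpace ℝ X] [MeasureSpace X]
  [NormedAddCommGroup F] [NormedSpace ℝ F]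

/-- `g` is the weak (distributional) gradient of `f` on the open set `Ω`: for every real test
function `φ ∈ C_c^∞(Ω)` and every direction `v`, `∫_Ω (∂_v φ) f = - ∫_Ω φ (g v)`. -/
def HasWeakGradientOn (f : X → F) (g : X → X →L[ℝ] F) (Ω : Set X) : Prop :=
  ∀ φ : X → ℝ, ContDiff ℝ ∞ φ → HasCompactSupport φ → tsupport φ ⊆ Ω → ∀ v : X,
    ∫ x in Ω, (fderiv ℝ φ x v) • f x = - ∫ x in Ω, φ x • g x v

/-- `f ∈ W^{1,∞}(Ω)`: `f` is bounded on `Ω` and has a weak gradient in `L^∞(Ω)`. As the functions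
at hand are evaluated pointwise, `f` denotes the continuous representative of its class. -/
def MemW1Infty (f : X → F) (Ω : Set X) : Prop :=
  ContinuousOn f Ω ∧ MemLp f ∞ (volume.restrict Ω) ∧
    ∃ g : X → X →L[ℝ] F, MemLp g ∞ (volume.restrict Ω) ∧ HasWeakGradientOn f g Ω

end Sobolev

variable {N M n : ℕ}

/-- The spectral projector `Π_z` of a complex matrix `A` at `z`: the projector onto the generalized
eigenspace `⋃_k ker (A - z)^k` along `⋂_k range (A - z)^k`. When `z` is a semisimple eigenvalue
this is the projector onto `ker (A - z)` along `range (A - z)`. -/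
def eigenprojector (A : Matrix (Fin N) (Fin N) ℂ) (z : ℂ) : Matrix (Fin N) (Fin N) ℂ :=
  LinearMap.toMatrix' (Submodule.projection _ _
    (LinearMap.isCompl_iSup_ker_pow_iInf_range_pow (Matrix.toLin' (A - z • 1))))

/-- The eigenvalue `z` of `A` is semisimple: its eigenspace is its whole generalized eigenspace. -/
def IsSemisimpleEigenvalue (A : Matrix (Fin N) (Fin N) ℂ) (z : ℂ) : Prop :=
  z ∈ spectrum ℂ A ∧
    Module.End.maxGenEigenspace (Matrix.toLin' A) z = Module.End.eigenspace (Matrix.toLin' A) z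

/-- The family `A(a)`, `a ∈ Ω`, is uniformly strongly hyperbolic: all its (complex) eigenvalues are
real and semisimple, and all its eigenprojectors are bounded by one constant. -/
def UniformlyStronglyHyperbolicOn
    (A : EuclideanSpace ℝ (Fin n) → Matrix (Fin N) (Fin N) ℂ)
    (Ω : Set (EuclideanSpace ℝ (Fin n))) : Prop :=
  (∀ a ∈ Ω, ∀ z ∈ spectrum ℂ (A a), z.im = 0 ∧ IsSemisimpleEigenvalue (A a) z) ∧
    ∃ C : ℝ, ∀ a ∈ Ω, ∀ z ∈ spectrum ℂ (A a), ‖eigenprojector (A a) z‖ ≤ C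

/-- `S_A(a) = ∑_{λ ∈ Σ(a)} S(λ, a) Π_λ(a)`, the sum being over the real spectrum of `A(a)`. -/
def functionalCalculus
    (A : EuclideanSpace ℝ (Fin n) → Matrix (Fin N) (Fin N) ℂ)
    (S : ℝ × EuclideanSpace ℝ (Fin n) → Matrix (Fin M) (Fin N) ℂ)
    (a : EuclideanSpace ℝ (Fin n)) : Matrix (Fin M) (Fin N) ℂ :=
  ∑ l ∈ (Matrix.finite_real_spectrum (A := A a)).toFinset,
    S (l, a) * eigenprojector (A a) (l : ℂ)

end StrongHyp

end

/-!
A uniformly strongly hyperbolic family is a spectral resolution: with `P a l` the eigenprojectors,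
`1 = ∑ P a l`, `A a * P a l = P a l * A a = l • P a l`, the `P a l` are bounded by a constant `C`,
and there are at most `N` of them. The projectors need not depend continuously on `a`.
The proof rests on one identity, obtained by inserting both resolutions of the identity:
`S_A(b) - S_A(a) = ∑_{l, k} (S(l, b) - S(k, a)) P b l * P a k`, together with
`(l - k) P b l * P a k = P b l * (A b - A a) * P a k`. The weight of a pair `(l, k)` is therefore
bounded by `C²` and, off the diagonal, by `C² ‖A b - A a‖ / |l - k|`. See
`SpectralResolutionOn.spectralSum_sub` and `SpectralResolutionOn.norm_spectralSum_sub_le`.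

* Continuity: near `(k, a)`, `‖S(l, b) - S(k, a)‖ ≤ ε + L |l - k|`, and the identity turns `|l - k|`
  into `‖A b - A a‖`.
* `W^{1,∞}`: mollification shows that a continuous function with bounded weak gradient satisfies a
  Lipschitz estimate with one constant on all segments inside the domain
  (`MemW1Infty.exists_norm_sub_le`). The identity carries this estimate over from `A` and `S` to
  `S_A`. Conversely, by Rademacher's theorem, a bounded function that is Lipschitz with one constant
  on all balls inside the domain is of class `W^{1,∞}` (`memW1Infty_of_lipschitzOnWith_ball`).
* Smoothness: with `T(l, k, a)` the divided difference of `S(·, a)`, the identity gives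
  `dS_A(a) v = ∑_l (∂_v S)(l, a) P a l + ∑_k (∑_l T(l, k, a) P a l) dA(a) v P a k`
  (`SpectralResolutionOn.hasFDerivAt_spectralSum`). The inner sum over `l` is a spectral sum for the
  same family over the enlarged parameter space of the `(k, a)`, and the outer sum is again a
  spectral sum, so that `C^k` regularity follows by induction on `k`, for all parameter
  spaces and all target spaces at once (`contDiffOn_spectralSum`).
-/

namespace StrongHyp

open Filter Set
open scoped Topology

universe u

/-! ### Spectral resolutions of families in a Banach algebra -/

/-- `A a = ∑ l ∈ σ a, l • P a l` is a resolution of `A a`, `a ∈ Ω`, into at most `K` spectral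
components with coefficients `P a l` bounded by `C`. Idempotence and orthogonality of the `P a l`
are not part of the definition, since the comparison of two values of `A` does not use them. -/
structure SpectralResolutionOn {E R : Type*} [NormedRing R] [NormedAlgebra ℝ R] (A : E → R)
    (σ : E → Finset ℝ) (P : E → ℝ → R) (K : ℕ) (C : ℝ) (Ω : Set E) : Prop where
  sum_eq_one : ∀ a ∈ Ω, ∑ l ∈ σ a, P a l = 1
  mul_left : ∀ a ∈ Ω, ∀ l ∈ σ a, A a * P a l = l • P a l
  mul_right : ∀ a ∈ Ω, ∀ l ∈ σ a, P a l * A a = l • P a l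
  norm_le : ∀ a ∈ Ω, ∀ l ∈ σ a, ‖P a l‖ ≤ C
  card_le : ∀ a ∈ Ω, (σ a).card ≤ K

section Matrix

variable {N : ℕ} {A : Matrix (Fin N) (Fin N) ℂ} {z : ℂ}

lemma toLin'_sub_smul_one (A : Matrix (Fin N) (Fin N) ℂ) (z : ℂ) :
    Matrix.toLin' (A - z • 1) = Matrix.toLin' A - z • 1 := by
  rw [map_sub, map_smul, Matrix.toLin'_one]; rfl

/-- For a semisimple eigenvalue, `eigenprojector A z` projects onto the eigenspace. -/
lemma iSup_ker_pow_eq_ker (hz : IsSemisimpleEigenvalue A z) :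
    (⨆ k, LinearMap.ker (Matrix.toLin' (A - z • 1) ^ k)) =
      LinearMap.ker (Matrix.toLin' (A - z • 1)) := by
  refine le_antisymm (iSup_le fun k x hx => ?_) ?_
  · have h1 : x ∈ Module.End.maxGenEigenspace (Matrix.toLin' A) z := by
      rw [Module.End.mem_maxGenEigenspace]
      exact ⟨k, by rw [← toLin'_sub_smul_one]; exact hx⟩
    rw [hz.2, Module.End.mem_eigenspace_iff] at h1
    rw [LinearMap.mem_ker, toLin'_sub_smul_one, LinearMap.sub_apply, h1]
    simp
  · exact (congrArg LinearMap.ker (pow_one (Matrix.toLin' (A - z • 1)))).ge.trans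
      (le_iSup (fun k => LinearMap.ker (Matrix.toLin' (A - z • 1) ^ k)) 1)

lemma toLin'_eigenprojector (A : Matrix (Fin N) (Fin N) ℂ) (z : ℂ) :
    Matrix.toLin' (eigenprojector A z) = Submodule.projection _ _
      (LinearMap.isCompl_iSup_ker_pow_iInf_range_pow (Matrix.toLin' (A - z • 1))) := by
  rw [eigenprojector, Matrix.toLin'_toMatrix']

lemma mul_eigenprojector (hz : IsSemisimpleEigenvalue A z) :
    A * eigenprojector A z = z • eigenprojector A z := by
  have h : (A - z • 1) * eigenprojector A z = 0 := by
    apply Matrix.toLin'.injective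
    rw [Matrix.toLin'_mul, toLin'_eigenprojector, map_zero]
    refine LinearMap.ext fun x => ?_
    have h := Submodule.projection_apply_mem
      (LinearMap.isCompl_iSup_ker_pow_iInf_range_pow (Matrix.toLin' (A - z • 1))) x
    exact (iSup_ker_pow_eq_ker hz).le h
  rwa [sub_mul, sub_eq_zero, smul_mul_assoc, one_mul] at h

lemma eigenprojector_mul (hz : IsSemisimpleEigenvalue A z) :
    eigenprojector A z * A = z • eigenprojector A z := by
  have h : eigenprojector A z * (A - z • 1) = 0 := by
    apply Matrix.toLin'.injective
    rw [Matrix.toLin'_mul, toLin'_eigenprojector, map_zero]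
    refine LinearMap.ext fun x => ?_
    have hc := LinearMap.isCompl_iSup_ker_pow_iInf_range_pow (Matrix.toLin' (A - z • 1))
    rw [LinearMap.comp_apply, LinearMap.zero_apply, Submodule.projection_apply_eq_zero_iff]
    obtain ⟨u, hu, w, hw, rfl⟩ : ∃ u ∈ (⨆ k, LinearMap.ker (Matrix.toLin' (A - z • 1) ^ k)),
        ∃ w ∈ (⨅ k, LinearMap.range (Matrix.toLin' (A - z • 1) ^ k)), u + w = x := by
      rw [← Submodule.mem_sup, hc.sup_eq_top]; trivial
    rw [iSup_ker_pow_eq_ker hz, LinearMap.mem_ker] at hu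
    rw [map_add, hu, zero_add]
    rw [Submodule.mem_iInf] at hw ⊢
    intro k
    obtain ⟨y, rfl⟩ := hw k
    refine ⟨Matrix.toLin' (A - z • 1) y, ?_⟩
    rw [← Module.End.mul_apply, ← Module.End.mul_apply, ← pow_succ, ← pow_succ']
  rwa [mul_sub, sub_eq_zero, mul_smul_comm, mul_one] at h

lemma eigenprojector_apply_of_mem_eigenspace {x : Fin N → ℂ}
    (hx : x ∈ Module.End.eigenspace (Matrix.toLin' A) z) :
    Matrix.toLin' (eigenprojector A z) x = x := by
  rw [toLin'_eigenprojector]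
  refine Submodule.projection_apply_of_mem_left _ ?_
  refine le_iSup (fun k => LinearMap.ker (Matrix.toLin' (A - z • 1) ^ k)) 1 ?_
  rw [Module.End.mem_eigenspace_iff] at hx
  rw [pow_one, LinearMap.mem_ker, toLin'_sub_smul_one, LinearMap.sub_apply, hx]
  simp

/-- The eigenprojectors of a matrix with semisimple spectrum sum to the identity: the sum fixes each
eigenspace, and the eigenspaces span. -/
lemma sum_eigenprojector (hA : ∀ z ∈ spectrum ℂ A, z.im = 0 ∧ IsSemisimpleEigenvalue A z) :
    ∑ l ∈ (Matrix.finite_real_spectrum (A := A)).toFinset, eigenprojector A (l : ℂ) = 1 := by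
  set s := (Matrix.finite_real_spectrum (A := A)).toFinset with hs
  have hmem : ∀ l : ℝ, l ∈ s ↔ (l : ℂ) ∈ spectrum ℂ A := fun l => by
    rw [hs, Set.Finite.mem_toFinset, ← spectrum.algebraMap_mem_iff ℂ]; rfl
  apply Matrix.toLin'.injective
  have htop : (⊤ : Submodule ℂ (Fin N → ℂ)) ≤ LinearMap.eqLocus
      (Matrix.toLin' (∑ l ∈ s, eigenprojector A (l : ℂ))) (Matrix.toLin' 1) := by
    rw [← Module.End.iSup_maxGenEigenspace_eq_top (Matrix.toLin' A)]
    refine iSup_le fun z => ?_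
    by_cases hz : z ∈ spectrum ℂ A
    · obtain ⟨hre, hss⟩ := hA z hz
      rw [hss.2]
      intro x hx
      have hzr : ((z.re : ℝ) : ℂ) = z := Complex.ext rfl (by simp [hre])
      rw [LinearMap.mem_eqLocus, map_sum, LinearMap.sum_apply,
        Finset.sum_eq_single_of_mem z.re ((hmem _).2 (hzr ▸ hz)), hzr,
        eigenprojector_apply_of_mem_eigenspace hx, Matrix.toLin'_one, LinearMap.id_apply]
      intro l hl hlz
      have h1 := congrArg (fun B => Matrix.toLin' B x) (eigenprojector_mul (hA _ ((hmem l).1 hl)).2)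
      rw [Module.End.mem_eigenspace_iff] at hx
      simp only [Matrix.toLin'_mul, LinearMap.comp_apply, hx, map_smul, LinearMap.smul_apply] at h1
      have h2 : (z - l) • Matrix.toLin' (eigenprojector A (l : ℂ)) x = 0 := by
        rw [sub_smul, h1, sub_self]
      refine (smul_eq_zero.1 h2).resolve_left fun h => hlz ?_
      rw [sub_eq_zero.1 h, Complex.ofReal_re]
    -- Off the spectrum the generalized eigenspace is trivial.
    · have : Module.End.maxGenEigenspace (Matrix.toLin' A) z = ⊥ := by
        by_contra hne
        have : Module.End.HasEigenvalue (Matrix.toLin' A) z :=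
          Module.End.HasUnifEigenvalue.lt zero_lt_one hne
        rw [Module.End.hasEigenvalue_iff_mem_spectrum, Matrix.spectrum_toLin'] at this
        exact hz this
      rw [this]; exact bot_le
  exact LinearMap.ext fun x => htop (Submodule.mem_top (x := x))

lemma card_real_spectrum_le (A : Matrix (Fin N) (Fin N) ℂ) :
    (Matrix.finite_real_spectrum (A := A)).toFinset.card ≤ N := by
  have h0 : A.charpoly ≠ 0 := (Matrix.charpoly_monic A).ne_zero
  calc (Matrix.finite_real_spectrum (A := A)).toFinset.card
      = ((Matrix.finite_real_spectrum (A := A)).toFinset.image ((↑) : ℝ → ℂ)).card :=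
        (Finset.card_image_of_injective _ Complex.ofReal_injective).symm
    _ ≤ A.charpoly.roots.toFinset.card := by
        refine Finset.card_le_card fun z hz => ?_
        obtain ⟨l, hl, rfl⟩ := Finset.mem_image.1 hz
        rw [Set.Finite.mem_toFinset, ← spectrum.algebraMap_mem_iff ℂ,
          Matrix.mem_spectrum_iff_isRoot_charpoly] at hl
        rw [Multiset.mem_toFinset, Polynomial.mem_roots h0]
        exact hl
    _ ≤ Multiset.card A.charpoly.roots := Multiset.toFinset_card_le _
    _ ≤ A.charpoly.natDegree := Polynomial.card_roots' _
    _ = N := by rw [Matrix.charpoly_natDegree_eq_dim, Fintype.card_fin]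

end Matrix

lemma UniformlyStronglyHyperbolicOn.exists_spectralResolutionOn {n N : ℕ}
    {A : EuclideanSpace ℝ (Fin n) → Matrix (Fin N) (Fin N) ℂ} {Ω : Set (EuclideanSpace ℝ (Fin n))}
    (hA : UniformlyStronglyHyperbolicOn A Ω) :
    ∃ C, 0 ≤ C ∧ SpectralResolutionOn A (fun a => (Matrix.finite_real_spectrum (A := A a)).toFinset)
      (fun a l => eigenprojector (A a) (l : ℂ)) N C Ω := by
  obtain ⟨h, C, hC⟩ := hA
  have hmem : ∀ a, ∀ l : ℝ, l ∈ (Matrix.finite_real_spectrum (A := A a)).toFinset →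
      (l : ℂ) ∈ spectrum ℂ (A a) := fun a l hl => by
    rwa [Set.Finite.mem_toFinset, ← spectrum.algebraMap_mem_iff ℂ] at hl
  exact ⟨|C|, abs_nonneg C, fun a ha => sum_eigenprojector (h a ha),
    fun a ha l hl => mul_eigenprojector (h a ha _ (hmem a l hl)).2,
    fun a ha l hl => eigenprojector_mul (h a ha _ (hmem a l hl)).2,
    fun a ha l hl => (hC a ha _ (hmem a l hl)).trans (le_abs_self C),
    fun a _ => card_real_spectrum_le (A a)⟩

/-! ### The comparison identity, continuity and Lipschitz estimates -/

/-- `∑ l ∈ σ a, f (l, a) · P a l`, where `w · x` is written `m w x`. -/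
noncomputable def spectralSum {E R W : Type*} [NormedRing R] [NormedAlgebra ℝ R]
    [NormedAddCommGroup W] [NormedSpace ℝ W] (m : W →L[ℝ] R →L[ℝ] W) (σ : E → Finset ℝ)
    (P : E → ℝ → R) (f : ℝ × E → W) (a : E) : W :=
  ∑ l ∈ σ a, m (f (l, a)) (P a l)

namespace SpectralResolutionOn

variable {E R W : Type*} [NormedRing R] [NormedAlgebra ℝ R]
  [NormedAddCommGroup W] [NormedSpace ℝ W] {m : W →L[ℝ] R →L[ℝ] W}
  {A : E → R} {σ : E → Finset ℝ} {P : E → ℝ → R} {K : ℕ} {C : ℝ} {Ω : Set E} {f : ℝ × E → W}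
  {a b : E}

/-- Comparison identity: both sums are expanded against the other resolution of the identity, so
that only differences of values of `f` appear, weighted by `P b l * P a k`. -/
lemma spectralSum_sub (h : SpectralResolutionOn A σ P K C Ω) (ha : a ∈ Ω) (hb : b ∈ Ω) :
    spectralSum m σ P f b - spectralSum m σ P f a =
      ∑ l ∈ σ b, ∑ k ∈ σ a, m (f (l, b) - f (k, a)) (P b l * P a k) := by
  simp only [map_sub, sub_apply, Finset.sum_sub_distrib]
  congr 1
  · refine Finset.sum_congr rfl fun l _ => ?_
    rw [← map_sum, ← Finset.mul_sum, h.sum_eq_one a ha, mul_one]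
  · rw [Finset.sum_comm]
    refine Finset.sum_congr rfl fun k _ => ?_
    rw [← map_sum, ← Finset.sum_mul, h.sum_eq_one b hb, one_mul]

/-- The weights of `spectralSum_sub` are small off the diagonal `l = k`. -/
lemma mul_sub_mul (h : SpectralResolutionOn A σ P K C Ω) (ha : a ∈ Ω) (hb : b ∈ Ω) {l k : ℝ}
    (hl : l ∈ σ b) (hk : k ∈ σ a) :
    P b l * (A b - A a) * P a k = (l - k) • (P b l * P a k) := by
  rw [mul_sub, sub_mul, h.mul_right b hb l hl, mul_assoc _ (A a), h.mul_left a ha k hk, sub_smul,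
    smul_mul_assoc, mul_smul_comm]

lemma abs_le_norm (h : SpectralResolutionOn A σ P K C Ω) (ha : a ∈ Ω) {l : ℝ} (hl : l ∈ σ a)
    (hP : P a l ≠ 0) : |l| ≤ ‖A a‖ := by
  have h1 := norm_mul_le (A a) (P a l)
  rw [h.mul_left a ha l hl, norm_smul, Real.norm_eq_abs] at h1
  exact le_of_mul_le_mul_right h1 (norm_pos_iff.2 hP)

lemma norm_mul_le_sq (h : SpectralResolutionOn A σ P K C Ω) (ha : a ∈ Ω) (hb : b ∈ Ω) {l k : ℝ}
    (hl : l ∈ σ b) (hk : k ∈ σ a) : ‖P b l * P a k‖ ≤ C ^ 2 := by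
  have h1 := h.norm_le b hb l hl
  calc ‖P b l * P a k‖ ≤ ‖P b l‖ * ‖P a k‖ := norm_mul_le _ _
    _ ≤ C * C := mul_le_mul h1 (h.norm_le a ha k hk) (norm_nonneg _) ((norm_nonneg _).trans h1)
    _ = C ^ 2 := (sq C).symm

lemma abs_sub_mul_norm_mul_le (h : SpectralResolutionOn A σ P K C Ω) (ha : a ∈ Ω) (hb : b ∈ Ω)
    {l k : ℝ} (hl : l ∈ σ b) (hk : k ∈ σ a) :
    |l - k| * ‖P b l * P a k‖ ≤ C ^ 2 * ‖A b - A a‖ := by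
  have h1 := h.norm_le b hb l hl
  have h0 : 0 ≤ C := (norm_nonneg _).trans h1
  calc |l - k| * ‖P b l * P a k‖ = ‖P b l * (A b - A a) * P a k‖ := by
        rw [h.mul_sub_mul ha hb hl hk, norm_smul, Real.norm_eq_abs]
    _ ≤ ‖P b l * (A b - A a)‖ * ‖P a k‖ := norm_mul_le _ _
    _ ≤ (‖P b l‖ * ‖A b - A a‖) * ‖P a k‖ := by gcongr; exact norm_mul_le _ _
    _ ≤ (C * ‖A b - A a‖) * C := by gcongr; exact h.norm_le a ha k hk
    _ = C ^ 2 * ‖A b - A a‖ := by ring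

/-- The basic estimate: an approximate Lipschitz bound on `f` in the spectral variable gives the
same bound on the spectral sum, with the distance of spectral values replaced by
`‖A b - A a‖`. -/
lemma norm_spectralSum_sub_le (h : SpectralResolutionOn A σ P K C Ω) (ha : a ∈ Ω) (hb : b ∈ Ω)
    {ε L : ℝ} (hε : 0 ≤ ε) (hL : 0 ≤ L)
    (hf : ∀ l ∈ σ b, |l| ≤ ‖A b‖ → ∀ k ∈ σ a, ‖f (l, b) - f (k, a)‖ ≤ ε + L * |l - k|) :
    ‖spectralSum m σ P f b - spectralSum m σ P f a‖ ≤
      K ^ 2 * (‖m‖ * C ^ 2 * (ε + L * ‖A b - A a‖)) := by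
  rw [h.spectralSum_sub ha hb, ← Finset.sum_product']
  have hterm : ∀ p ∈ σ b ×ˢ σ a, ‖m (f (p.1, b) - f (p.2, a)) (P b p.1 * P a p.2)‖ ≤
      ‖m‖ * C ^ 2 * (ε + L * ‖A b - A a‖) := by
    rintro ⟨l, k⟩ hp
    obtain ⟨hl, hk⟩ := Finset.mem_product.1 hp
    dsimp only at hl hk ⊢
    -- A spectral value with `P b l = 0` is not controlled by `A b`, but contributes nothing.
    by_cases hP : P b l = 0
    · rw [hP, zero_mul, map_zero, norm_zero]; positivity
    · calc ‖m (f (l, b) - f (k, a)) (P b l * P a k)‖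
          ≤ ‖m‖ * ‖f (l, b) - f (k, a)‖ * ‖P b l * P a k‖ := m.le_opNorm₂ _ _
        _ ≤ ‖m‖ * (ε + L * |l - k|) * ‖P b l * P a k‖ := by
            gcongr; exact hf l hl (h.abs_le_norm hb hl hP) k hk
        _ = ‖m‖ * (ε * ‖P b l * P a k‖ + L * (|l - k| * ‖P b l * P a k‖)) := by ring
        _ ≤ ‖m‖ * (ε * C ^ 2 + L * (C ^ 2 * ‖A b - A a‖)) := by
            have h1 := h.norm_mul_le_sq ha hb hl hk
            have h2 := h.abs_sub_mul_norm_mul_le ha hb hl hk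
            refine mul_le_mul_of_nonneg_left (add_le_add ?_ ?_) (norm_nonneg m)
            · exact mul_le_mul_of_nonneg_left h1 hε
            · exact mul_le_mul_of_nonneg_left h2 hL
        _ = ‖m‖ * C ^ 2 * (ε + L * ‖A b - A a‖) := by ring
  refine (norm_sum_le_of_le _ hterm).trans ?_
  rw [Finset.sum_const, Finset.card_product, nsmul_eq_mul]
  gcongr
  rw [sq]
  exact_mod_cast Nat.mul_le_mul (h.card_le b hb) (h.card_le a ha)

lemma norm_spectralSum_le (h : SpectralResolutionOn A σ P K C Ω) (ha : a ∈ Ω) {B : ℝ}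
    (hB : 0 ≤ B) (hC : 0 ≤ C) (hf : ∀ l, ‖f (l, a)‖ ≤ B) :
    ‖spectralSum m σ P f a‖ ≤ K * (‖m‖ * B * C) := by
  have hterm : ∀ l ∈ σ a, ‖m (f (l, a)) (P a l)‖ ≤ ‖m‖ * B * C := fun l hl =>
    (m.le_opNorm₂ _ _).trans (by gcongr; exacts [hf l, h.norm_le a ha l hl])
  refine (norm_sum_le_of_le _ hterm).trans ?_
  rw [Finset.sum_const, nsmul_eq_mul]
  gcongr
  exact_mod_cast h.card_le a ha

end SpectralResolutionOn

/-- Points with `|l - k| < δ` are covered by continuity at `(k, a)`, the others by the bound of `f`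
on a compact set, divided by `δ`. -/
lemma exists_norm_sub_le_add_mul {E W : Type*} [NormedAddCommGroup E] [NormedSpace ℝ E]
    [FiniteDimensional ℝ E] [NormedAddCommGroup W] {Ω : Set E} {f : ℝ × E → W} {a : E}
    (hΩ : IsOpen Ω) (hf : ContinuousOn f (univ ×ˢ Ω)) (ha : a ∈ Ω) (k T : ℝ) {ε : ℝ} (hε : 0 < ε) :
    ∃ L, 0 ≤ L ∧ ∀ᶠ b in 𝓝 a, ∀ l, |l| ≤ T → ‖f (l, b) - f (k, a)‖ ≤ ε + L * |l - k| := by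
  have : ProperSpace E := FiniteDimensional.proper ℝ E
  obtain ⟨r, hr, hrΩ⟩ := Metric.nhds_basis_closedBall.mem_iff.1 (hΩ.mem_nhds ha)
  have hQ : IsCompact (Icc (-T) T ×ˢ Metric.closedBall a r) :=
    isCompact_Icc.prod (isCompact_closedBall a r)
  obtain ⟨B, hB⟩ := hQ.exists_bound_of_continuousOn
    (hf.mono (prod_mono (subset_univ _) hrΩ))
  have hfa : ContinuousAt f (k, a) :=
    hf.continuousAt ((isOpen_univ.prod hΩ).mem_nhds ⟨trivial, ha⟩)
  obtain ⟨δ, hδ, hδf⟩ := Metric.continuousAt_iff.1 hfa ε hε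
  refine ⟨(|B| + ‖f (k, a)‖) / δ, by positivity, ?_⟩
  filter_upwards [Metric.closedBall_mem_nhds a hr, Metric.ball_mem_nhds a hδ] with b hbr hbδ l hl
  rcases lt_or_ge |l - k| δ with hlk | hlk
  · have h1 := hδf (x := (l, b)) (by
      rw [Prod.dist_eq]; exact max_lt (by rwa [Real.dist_eq]) hbδ)
    rw [dist_eq_norm] at h1
    have : 0 ≤ (|B| + ‖f (k, a)‖) / δ * |l - k| := by positivity
    linarith
  · have h1 : ‖f (l, b) - f (k, a)‖ ≤ |B| + ‖f (k, a)‖ :=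
      (norm_sub_le _ _).trans (by
        gcongr; exact (hB (l, b) ⟨abs_le.1 hl, hbr⟩).trans (le_abs_self B))
    have h2 : |B| + ‖f (k, a)‖ ≤ (|B| + ‖f (k, a)‖) / δ * |l - k| := by
      rw [div_mul_eq_mul_div, le_div_iff₀ hδ]
      gcongr
    linarith

section Continuity

variable {E R W : Type*} [NormedAddCommGroup E] [NormedSpace ℝ E] [FiniteDimensional ℝ E]
  [NormedRing R] [NormedAlgebra ℝ R]
  [NormedAddCommGroup W] [NormedSpace ℝ W] {m : W →L[ℝ] R →L[ℝ] W}
  {A : E → R} {σ : E → Finset ℝ} {P : E → ℝ → R} {K : ℕ} {C : ℝ} {Ω : Set E} {f : ℝ × E → W}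
  {a : E}

theorem SpectralResolutionOn.continuousOn_spectralSum (h : SpectralResolutionOn A σ P K C Ω)
    (hΩ : IsOpen Ω) (hA : ContinuousOn A Ω) (hf : ContinuousOn f (univ ×ˢ Ω)) :
    ContinuousOn (spectralSum m σ P f) Ω := by
  intro a ha
  refine ContinuousAt.continuousWithinAt ?_
  have hAa : ContinuousAt A a := hA.continuousAt (hΩ.mem_nhds ha)
  rw [Metric.continuousAt_iff']
  intro ε hε
  have hD : 0 < (K : ℝ) ^ 2 * (‖m‖ * C ^ 2) + 1 := by positivity
  set ε' := ε / ((K : ℝ) ^ 2 * (‖m‖ * C ^ 2) + 1) / 2 with hε'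
  have hε'0 : 0 < ε' := by positivity
  choose L hL0 hL using fun k => exists_norm_sub_le_add_mul hΩ hf ha k (‖A a‖ + 1) hε'0
  have hev : ∀ᶠ b in 𝓝 a, ∀ k ∈ σ a, ∀ l, |l| ≤ ‖A a‖ + 1 →
      ‖f (l, b) - f (k, a)‖ ≤ ε' + L k * |l - k| :=
    (Filter.eventually_all_finset (σ a)).2 fun k _ => hL k
  have hLs : 0 ≤ ∑ k ∈ σ a, L k := Finset.sum_nonneg fun k _ => hL0 k
  have hnorm : ∀ᶠ b in 𝓝 a, ‖A b‖ < ‖A a‖ + 1 := hAa.norm.eventually_lt_const (lt_add_one _)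
  have hsmall : ∀ᶠ b in 𝓝 a, (∑ k ∈ σ a, L k) * ‖A b - A a‖ < ε' := by
    have : Tendsto (fun b => (∑ k ∈ σ a, L k) * ‖A b - A a‖) (𝓝 a) (𝓝 0) := by
      have h0 : ContinuousAt (fun b => (∑ k ∈ σ a, L k) * ‖A b - A a‖) a := by fun_prop
      simpa [ContinuousAt] using h0
    exact this.eventually_lt_const hε'0
  filter_upwards [hev, hnorm, hsmall, hΩ.mem_nhds ha] with b h1 h2 h3 hb
  rw [dist_eq_norm]
  have h4 := h.norm_spectralSum_sub_le (m := m) (f := f) ha hb hε'0.le hLs fun l _ hlA k hk =>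
    (h1 k hk l (hlA.trans h2.le)).trans (by
      gcongr; exact Finset.single_le_sum (fun k _ => hL0 k) hk)
  calc _ ≤ _ := h4
    _ ≤ (K : ℝ) ^ 2 * (‖m‖ * C ^ 2 * (ε' + ε')) := by gcongr
    _ < ((K : ℝ) ^ 2 * (‖m‖ * C ^ 2) + 1) * (ε' + ε') := by nlinarith
    _ = ε := by rw [hε']; field_simp; ring

end Continuity

/-! ### Smoothness of integrals depending on a parameter -/

section ParametricIntegral

lemma continuousOn_intervalIntegral_param {X W : Type*} [TopologicalSpace X]
    [NormedAddCommGroup W] [NormedSpace ℝ W] {V : Set X} {F : X × ℝ → W}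
    (hF : ContinuousOn F (V ×ˢ univ)) :
    ContinuousOn (fun x => ∫ s in (0 : ℝ)..1, F (x, s)) V := by
  rw [continuousOn_iff_continuous_domRestrict]
  refine intervalIntegral.continuous_parametric_intervalIntegral_of_continuous'
    (f := fun (x : V) (s : ℝ) => F (x, s)) (μ := volume) ?_ 0 1
  exact hF.comp_continuous (f := fun q : V × ℝ => ((q.1 : X), q.2)) (by fun_prop)
    fun q => ⟨q.1.2, trivial⟩

variable {X W : Type u} [NormedAddCommGroup X] [NormedSpace ℝ X] [FiniteDimensional ℝ X]
  [NormedAddCommGroup W] [NormedSpace ℝ W]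

lemma hasFDerivAt_intervalIntegral_param {V : Set X} (hV : IsOpen V) {F : X × ℝ → W}
    (hF : ContDiffOn ℝ 1 F (V ×ˢ univ)) {x : X} (hx : x ∈ V) :
    HasFDerivAt (fun x => ∫ s in (0 : ℝ)..1, F (x, s))
      (∫ s in (0 : ℝ)..1, (fderiv ℝ F (x, s)).comp (ContinuousLinearMap.inl ℝ X ℝ)) x := by
  have : ProperSpace X := FiniteDimensional.proper ℝ X
  have hVo : IsOpen (V ×ˢ (univ : Set ℝ)) := hV.prod isOpen_univ
  have hD : ContinuousOn
      (fun q => (fderiv ℝ F q).comp (ContinuousLinearMap.inl ℝ X ℝ)) (V ×ˢ univ) :=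
    (hF.continuousOn_fderiv_of_isOpen hVo le_rfl).clm_comp continuousOn_const
  obtain ⟨r, hr, hrV⟩ := Metric.nhds_basis_closedBall.mem_iff.1 (hV.mem_nhds hx)
  obtain ⟨B, hB⟩ := ((isCompact_closedBall x r).prod
    (isCompact_Icc (a := (0 : ℝ)) (b := 1))).exists_bound_of_continuousOn
    (hD.mono (prod_mono hrV (subset_univ _)))
  have hslice : ∀ y ∈ V, Continuous fun s : ℝ => F (y, s) := fun y hy =>
    hF.continuousOn.comp_continuous (by fun_prop) fun s => ⟨hy, trivial⟩
  refine intervalIntegral.hasFDerivAt_integral_of_dominated_of_fderiv_le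
    (F := fun y s => F (y, s)) (bound := fun _ => B)
    (F' := fun y s => (fderiv ℝ F (y, s)).comp (ContinuousLinearMap.inl ℝ X ℝ))
    (Metric.closedBall_mem_nhds x hr) ?_ ?_ ?_ ?_ ?_ ?_
  · filter_upwards [hV.mem_nhds hx] with y hy using (hslice y hy).aestronglyMeasurable
  · exact (hslice x hx).intervalIntegrable _ _
  · exact (hD.comp_continuous (f := fun s : ℝ => (x, s)) (by fun_prop)
      fun s => ⟨hx, trivial⟩).aestronglyMeasurable
  · refine Eventually.of_forall fun s hs y hy => hB (y, s) ⟨hy, ?_⟩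
    rw [uIoc_of_le zero_le_one] at hs
    exact Ioc_subset_Icc_self hs
  · exact intervalIntegrable_const
  · refine Eventually.of_forall fun s _ y hy => ?_
    have h1 : HasFDerivAt F (fderiv ℝ F (y, s)) (y, s) :=
      ((hF.contDiffAt (hVo.mem_nhds ⟨hrV hy, trivial⟩)).differentiableAt
        one_ne_zero).hasFDerivAt
    exact h1.comp y (hasFDerivAt_prodMk_left y s)

lemma contDiffOn_intervalIntegral_param {k : ℕ} : ∀ {W : Type u} [NormedAddCommGroup W]
    [NormedSpace ℝ W] {V : Set X} (_ : IsOpen V) {F : X × ℝ → W}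
    (_ : ContDiffOn ℝ k F (V ×ˢ univ)),
    ContDiffOn ℝ k (fun x => ∫ s in (0 : ℝ)..1, F (x, s)) V := by
  induction k with
  | zero =>
    intro W _ _ V hV F hF
    rw [Nat.cast_zero, contDiffOn_zero] at hF ⊢
    exact continuousOn_intervalIntegral_param hF
  | succ k ih =>
    intro W _ _ V hV F hF
    have hVo : IsOpen (V ×ˢ (univ : Set ℝ)) := hV.prod isOpen_univ
    have hder := fun x (hx : x ∈ V) => hasFDerivAt_intervalIntegral_param hV
      (hF.of_le (by norm_cast; omega)) hx
    rw [Nat.cast_add, Nat.cast_one, contDiffOn_succ_iff_fderiv_of_isOpen hVo] at hF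
    rw [Nat.cast_add, Nat.cast_one, contDiffOn_succ_iff_fderiv_of_isOpen hV]
    refine ⟨fun x hx => (hder x hx).differentiableAt.differentiableWithinAt, by simp, ?_⟩
    refine (ih hV (F := fun q => (fderiv ℝ F q).comp (ContinuousLinearMap.inl ℝ X ℝ))
      (hF.2.2.clm_comp contDiffOn_const)).congr fun x hx => (hder x hx).fderiv

end ParametricIntegral

/-! ### Differentiation of spectral sums -/

section Derivative

/-- The difference quotient `(f (l, a) - f (k, a)) / (l - k)`, extended to the diagonal: the mean of
the derivative `∂f/∂l` over the segment from `k` to `l`. -/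
noncomputable def dividedDifference {E W : Type*} [NormedAddCommGroup E] [NormedSpace ℝ E]
    [NormedAddCommGroup W] [NormedSpace ℝ W] (f : ℝ × E → W) (q : ℝ × ℝ × E) : W :=
  ∫ s in (0 : ℝ)..1, fderiv ℝ f (q.2.1 + s * (q.1 - q.2.1), q.2.2) (1, 0)

lemma continuousOn_dividedDifference {E W : Type*} [NormedAddCommGroup E] [NormedSpace ℝ E]
    [NormedAddCommGroup W] [NormedSpace ℝ W] {Ω : Set E} (hΩ : IsOpen Ω)
    {f : ℝ × E → W} (hf : ContDiffOn ℝ 1 f (univ ×ˢ Ω)) :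
    ContinuousOn (dividedDifference f) (univ ×ˢ (univ ×ˢ Ω)) := by
  refine continuousOn_intervalIntegral_param
    (F := fun z : (ℝ × ℝ × E) × ℝ => fderiv ℝ f (z.1.2.1 + z.2 * (z.1.1 - z.1.2.1), z.1.2.2) (1, 0))
    (ContinuousOn.clm_apply ?_ continuousOn_const)
  exact (hf.continuousOn_fderiv_of_isOpen (isOpen_univ.prod hΩ) le_rfl).comp
    (f := fun z : (ℝ × ℝ × E) × ℝ => (z.1.2.1 + z.2 * (z.1.1 - z.1.2.1), z.1.2.2))
    (by fun_prop) fun z hz => ⟨trivial, hz.1.2.2⟩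

lemma contDiffOn_dividedDifference {E W : Type u} [NormedAddCommGroup E] [NormedSpace ℝ E]
    [FiniteDimensional ℝ E] [NormedAddCommGroup W] [NormedSpace ℝ W] {Ω : Set E} (hΩ : IsOpen Ω)
    {f : ℝ × E → W} {k : ℕ} (hf : ContDiffOn ℝ (k + 1) f (univ ×ˢ Ω)) :
    ContDiffOn ℝ k (dividedDifference f) (univ ×ˢ (univ ×ˢ Ω)) := by
  have hU : IsOpen ((univ : Set ℝ) ×ˢ Ω) := isOpen_univ.prod hΩ
  have h1 := ((contDiffOn_succ_iff_fderiv_of_isOpen hU).1 hf).2.2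
  refine contDiffOn_intervalIntegral_param
    (F := fun z : (ℝ × ℝ × E) × ℝ => fderiv ℝ f (z.1.2.1 + z.2 * (z.1.1 - z.1.2.1), z.1.2.2) (1, 0))
    (isOpen_univ.prod hU) (ContDiffOn.clm_apply ?_ contDiffOn_const)
  exact h1.comp (g := fderiv ℝ f)
    (f := fun z : (ℝ × ℝ × E) × ℝ => (z.1.2.1 + z.2 * (z.1.1 - z.1.2.1), z.1.2.2))
    (ContDiff.contDiffOn (by fun_prop)) fun z hz => ⟨trivial, hz.1.2.2⟩

lemma sub_eq_smul_dividedDifference {E W : Type*} [NormedAddCommGroup E] [NormedSpace ℝ E]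
    [NormedAddCommGroup W] [NormedSpace ℝ W] [CompleteSpace W] {Ω : Set E} (hΩ : IsOpen Ω)
    {f : ℝ × E → W} (hf : ContDiffOn ℝ 1 f (univ ×ˢ Ω)) {a : E} (ha : a ∈ Ω) (l k : ℝ) :
    f (l, a) - f (k, a) = (l - k) • dividedDifference f (l, k, a) := by
  have hU : IsOpen ((univ : Set ℝ) ×ˢ Ω) := isOpen_univ.prod hΩ
  have hc : Continuous fun s : ℝ =>
      fderiv ℝ f (k + s * (l - k), a) (1, 0) :=
    ((hf.continuousOn_fderiv_of_isOpen hU le_rfl).clm_apply continuousOn_const).comp_continuous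
      (f := fun s : ℝ => (k + s * (l - k), a)) (by fun_prop) fun s => ⟨trivial, ha⟩
  have hd : ∀ s ∈ uIcc (0 : ℝ) 1, HasDerivAt (fun s : ℝ => f (k + s * (l - k), a))
      ((l - k) • fderiv ℝ f (k + s * (l - k), a) (1, 0)) s := fun s _ => by
    have h1 : HasFDerivAt f (fderiv ℝ f (k + s * (l - k), a)) (k + s * (l - k), a) :=
      ((hf.contDiffAt (hU.mem_nhds ⟨trivial, ha⟩)).differentiableAt one_ne_zero).hasFDerivAt
    have h2 : HasDerivAt (fun s : ℝ => (k + s * (l - k), a)) (l - k, 0) s := by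
      have h3 : HasDerivAt (fun s : ℝ => k + s * (l - k)) (l - k) s := by
        simpa using ((hasDerivAt_id s).mul_const (l - k)).const_add k
      exact h3.prodMk (hasDerivAt_const s a)
    have h4 := h1.comp_hasDerivAt s h2
    have h5 : ((l - k, 0) : ℝ × E) = (l - k) • (1, 0) := by simp
    rw [h5, map_smul] at h4
    exact h4
  have h := intervalIntegral.integral_eq_sub_of_hasDerivAt hd
    ((hc.const_smul (l - k)).intervalIntegrable _ _)
  rw [intervalIntegral.integral_smul] at h
  rw [dividedDifference, h]
  simp

/-- A first order Taylor estimate in `a`, uniform for bounded `l`. -/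
lemma eventually_norm_sub_sub_le {E W : Type*} [NormedAddCommGroup E] [NormedSpace ℝ E]
    [FiniteDimensional ℝ E] [NormedAddCommGroup W] [NormedSpace ℝ W] {Ω : Set E} (hΩ : IsOpen Ω)
    {f : ℝ × E → W} (hf : ContDiffOn ℝ 1 f (univ ×ˢ Ω)) {a : E} (ha : a ∈ Ω) (T : ℝ) {ε : ℝ}
    (hε : 0 < ε) :
    ∀ᶠ b in 𝓝 a, ∀ l, |l| ≤ T →
      ‖f (l, b) - f (l, a) - (fderiv ℝ f (l, a)).comp (ContinuousLinearMap.inr ℝ ℝ E) (b - a)‖ ≤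
        ε * ‖b - a‖ := by
  have : ProperSpace E := FiniteDimensional.proper ℝ E
  have hU : IsOpen ((univ : Set ℝ) ×ˢ Ω) := isOpen_univ.prod hΩ
  have hD : ContinuousOn
      (fun q => (fderiv ℝ f q).comp (ContinuousLinearMap.inr ℝ ℝ E)) (univ ×ˢ Ω) :=
    (hf.continuousOn_fderiv_of_isOpen hU le_rfl).clm_comp continuousOn_const
  obtain ⟨r, hr, hrΩ⟩ := Metric.nhds_basis_closedBall.mem_iff.1 (hΩ.mem_nhds ha)
  have hQ : IsCompact (Icc (-T) T ×ˢ Metric.closedBall a r) :=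
    isCompact_Icc.prod (isCompact_closedBall a r)
  have huc := hQ.uniformContinuousOn_of_continuous (hD.mono (prod_mono (subset_univ _) hrΩ))
  obtain ⟨δ, hδ, hδD⟩ := Metric.uniformContinuousOn_iff.1 huc ε hε
  have hρ : 0 < min r δ := lt_min hr hδ
  filter_upwards [Metric.ball_mem_nhds a hρ] with b hb l hl
  have hsub : Metric.ball a (min r δ) ⊆ Metric.closedBall a r :=
    (Metric.ball_subset_ball (min_le_left _ _)).trans Metric.ball_subset_closedBall
  refine (convex_ball a (min r δ)).norm_image_sub_le_of_norm_hasFDerivWithin_le'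
    (f := fun c => f (l, c))
    (f' := fun c => (fderiv ℝ f (l, c)).comp (ContinuousLinearMap.inr ℝ ℝ E)) (fun c hc => ?_)
    (fun c hc => ?_) (Metric.mem_ball_self hρ) hb
  · have h1 : HasFDerivAt f (fderiv ℝ f (l, c)) (l, c) :=
      ((hf.contDiffAt (hU.mem_nhds ⟨trivial, hrΩ (hsub hc)⟩)).differentiableAt
        one_ne_zero).hasFDerivAt
    exact (h1.comp c (hasFDerivAt_prodMk_right l c)).hasFDerivWithinAt
  · rw [← dist_eq_norm]
    refine (hδD (l, c) ⟨abs_le.1 hl, hsub hc⟩ (l, a)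
      ⟨abs_le.1 hl, Metric.mem_closedBall_self hr.le⟩ ?_).le
    rw [Prod.dist_eq, dist_self]
    exact max_lt hδ ((Metric.mem_ball.1 hc).trans_le (min_le_right _ _))

/-- Product rule at a zero of the second factor: continuity of the first factor suffices. -/
lemma hasFDerivAt_clm_apply_of_eq_zero {E F G : Type*} [NormedAddCommGroup E] [NormedSpace ℝ E]
    [NormedAddCommGroup F] [NormedSpace ℝ F] [NormedAddCommGroup G] [NormedSpace ℝ G]
    {L : E → F →L[ℝ] G} {u : E → F} {u' : E →L[ℝ] F} {a : E} (hL : ContinuousAt L a)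
    (hu : HasFDerivAt u u' a) (h0 : u a = 0) :
    HasFDerivAt (fun b => L b (u b)) ((L a).comp u') a := by
  have h1 : HasFDerivAt (fun b => L a (u b)) ((L a).comp u') a := (L a).hasFDerivAt.comp a hu
  have h2 : HasFDerivAt (fun b => (L b - L a) (u b)) (0 : E →L[ℝ] G) a := by
    rw [hasFDerivAt_iff_isLittleO]
    have hO : (fun b => u b) =O[𝓝 a] fun b => b - a := by simpa [h0] using hu.isBigO_sub
    have ho : (fun b => L b - L a) =o[𝓝 a] fun _ => (1 : ℝ) := by
      rw [Asymptotics.isLittleO_one_iff]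
      have h3 : ContinuousAt (fun b => L b - L a) a := hL.sub continuousAt_const
      simpa [ContinuousAt] using h3
    have h3 : (fun b => (L b - L a) (u b)) =O[𝓝 a] fun b => ‖L b - L a‖ * ‖u b‖ :=
      Asymptotics.IsBigO.of_bound 1 (Eventually.of_forall fun b => by
        rw [Real.norm_of_nonneg (by positivity), one_mul]
        exact (L b - L a).le_opNorm _)
    have h4 := h3.trans_isLittleO (ho.norm_left.mul_isBigO hO.norm_norm)
    simpa [h0] using h4
  have h3 := h1.add h2
  rw [add_zero] at h3
  exact h3.congr_of_eventuallyEq (Eventually.of_forall fun b => by simp)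

/-- The right action `w · x = m w x` of `R` on `W`, extended pointwise to linear maps into `W`. -/
noncomputable def actionOnMaps (E : Type*) {R W : Type*} [NormedAddCommGroup E] [NormedSpace ℝ E]
    [NormedRing R] [NormedAlgebra ℝ R] [NormedAddCommGroup W] [NormedSpace ℝ W]
    (m : W →L[ℝ] R →L[ℝ] W) : (E →L[ℝ] W) →L[ℝ] R →L[ℝ] (E →L[ℝ] W) :=
  ((ContinuousLinearMap.compL ℝ E W W).comp m.flip).flip

lemma actionOnMaps_apply {E R W : Type*} [NormedAddCommGroup E] [NormedSpace ℝ E]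
    [NormedRing R] [NormedAlgebra ℝ R] [NormedAddCommGroup W] [NormedSpace ℝ W]
    (m : W →L[ℝ] R →L[ℝ] W) (φ : E →L[ℝ] W) (x : R) (v : E) :
    actionOnMaps E m φ x v = m (φ v) x := rfl

end Derivative

namespace SpectralResolutionOn

variable {E R W : Type*} [NormedAddCommGroup E] [NormedSpace ℝ E] [FiniteDimensional ℝ E]
  [NormedRing R] [NormedAlgebra ℝ R]
  [NormedAddCommGroup W] [NormedSpace ℝ W] {m : W →L[ℝ] R →L[ℝ] W}
  {A : E → R} {σ : E → Finset ℝ} {P : E → ℝ → R} {K : ℕ} {C : ℝ} {Ω : Set E} {f : ℝ × E → W}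
  {a : E}

/-- The contribution of the variation of `f` in its second argument to the derivative of the
spectral sum. -/
lemma hasFDerivAt_spectralSum_const_spectrum (h : SpectralResolutionOn A σ P K C Ω) (hΩ : IsOpen Ω)
    (hA : ContinuousOn A Ω) (hf : ContDiffOn ℝ 1 f (univ ×ˢ Ω)) (ha : a ∈ Ω) :
    HasFDerivAt (fun b => ∑ l ∈ σ b, m (f (l, b) - f (l, a)) (P b l))
      (spectralSum (actionOnMaps E m) σ P
        (fun q => (fderiv ℝ f q).comp (ContinuousLinearMap.inr ℝ ℝ E)) a) a := by
  set f' : ℝ × E → E →L[ℝ] W := fun q => (fderiv ℝ f q).comp (ContinuousLinearMap.inr ℝ ℝ E)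
    with hf'
  have hU : IsOpen ((univ : Set ℝ) ×ˢ Ω) := isOpen_univ.prod hΩ
  have hf'c : ContinuousOn f' (univ ×ˢ Ω) :=
    (hf.continuousOn_fderiv_of_isOpen hU le_rfl).clm_comp continuousOn_const
  have hAa : ContinuousAt A a := hA.continuousAt (hΩ.mem_nhds ha)
  -- `f'` is frozen at `a`, so that the sum is a continuous function of `b` applied to `b - a`.
  set Λ : E → E →L[ℝ] W := spectralSum (actionOnMaps E m) σ P (fun q => f' (q.1, a)) with hΛ
  have hΛc : ContinuousAt Λ a := by
    refine (h.continuousOn_spectralSum hΩ hA ?_).continuousAt (hΩ.mem_nhds ha)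
    exact hf'c.comp (by fun_prop) fun q _ => ⟨trivial, ha⟩
  have hlin : HasFDerivAt (fun b => Λ b (b - a)) (Λ a) a := by
    simpa using hasFDerivAt_clm_apply_of_eq_zero hΛc ((hasFDerivAt_id a).sub_const a) (sub_self a)
  have hrem : HasFDerivAt (fun b => ∑ l ∈ σ b,
      m (f (l, b) - f (l, a) - f' (l, a) (b - a)) (P b l)) (0 : E →L[ℝ] W) a := by
    rw [hasFDerivAt_iff_isLittleO, Asymptotics.isLittleO_iff]
    intro c hc
    have hD : 0 < (K : ℝ) * (‖m‖ * |C|) + 1 := by positivity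
    have hε : 0 < c / ((K : ℝ) * (‖m‖ * |C|) + 1) := by positivity
    have hnorm : ∀ᶠ b in 𝓝 a, ‖A b‖ < ‖A a‖ + 1 := hAa.norm.eventually_lt_const (lt_add_one _)
    filter_upwards [eventually_norm_sub_sub_le hΩ hf ha (‖A a‖ + 1) hε, hnorm, hΩ.mem_nhds ha]
      with b h1 h2 hb
    have h0 : ∑ l ∈ σ a, m (f (l, a) - f (l, a) - f' (l, a) (a - a)) (P a l) = 0 := by simp
    rw [h0, zero_apply, sub_zero, sub_zero]
    set ε := c / ((K : ℝ) * (‖m‖ * |C|) + 1)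
    have hterm : ∀ l ∈ σ b, ‖m (f (l, b) - f (l, a) - f' (l, a) (b - a)) (P b l)‖ ≤
        ‖m‖ * (ε * ‖b - a‖) * |C| := fun l hl => by
      by_cases hP : P b l = 0
      · rw [hP, map_zero, norm_zero]; positivity
      · refine (m.le_opNorm₂ _ _).trans ?_
        have h3 := h1 l ((h.abs_le_norm hb hl hP).trans h2.le)
        have h4 := (h.norm_le b hb l hl).trans (le_abs_self C)
        gcongr
    refine (norm_sum_le_of_le _ hterm).trans ?_
    rw [Finset.sum_const, nsmul_eq_mul]
    calc ((σ b).card : ℝ) * (‖m‖ * (ε * ‖b - a‖) * |C|)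
        ≤ K * (‖m‖ * (ε * ‖b - a‖) * |C|) := by
          gcongr; exact_mod_cast h.card_le b hb
      _ = (K * (‖m‖ * |C|)) * ε * ‖b - a‖ := by ring
      _ ≤ (K * (‖m‖ * |C|) + 1) * ε * ‖b - a‖ := by gcongr; linarith
      _ = c * ‖b - a‖ := by rw [mul_div_cancel₀ _ hD.ne']
  have hsum := hlin.add hrem
  rw [add_zero] at hsum
  refine hsum.congr_of_eventuallyEq (Eventually.of_forall fun b => ?_)
  simp only [Pi.add_apply]
  rw [hΛ, spectralSum, sum_apply, ← Finset.sum_add_distrib]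
  refine Finset.sum_congr rfl fun l _ => ?_
  rw [actionOnMaps_apply, ← add_apply, ← map_add, add_sub_cancel]

/-- The contribution of the variation of `A` to the derivative of the spectral sum. -/
lemma hasFDerivAt_spectralSum_const_param [CompleteSpace W]
    (hm : ∀ w x y, m (m w x) y = m w (x * y)) (h : SpectralResolutionOn A σ P K C Ω)
    (hΩ : IsOpen Ω) (hA : ContDiffOn ℝ 1 A Ω) (hf : ContDiffOn ℝ 1 f (univ ×ˢ Ω)) (ha : a ∈ Ω) :
    HasFDerivAt (spectralSum m σ P fun q => f (q.1, a))
      (spectralSum (actionOnMaps E m) σ P (fun q =>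
        (m (spectralSum m (fun p : ℝ × E => σ p.2) (fun p => P p.2) (dividedDifference f) q)).comp
          (fderiv ℝ A q.2)) a) a := by
  have hAa : HasFDerivAt A (fderiv ℝ A a) a :=
    ((hA.contDiffAt (hΩ.mem_nhds ha)).differentiableAt one_ne_zero).hasFDerivAt
  have hu : HasFDerivAt (fun b => A b - A a) (fderiv ℝ A a) a := hAa.sub_const _
  have hT : ∀ k, ContinuousAt
      (spectralSum m σ P fun q => dividedDifference f (q.1, k, a)) a := fun k => by
    refine (h.continuousOn_spectralSum hΩ hA.continuousOn ?_).continuousAt (hΩ.mem_nhds ha)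
    have hc := continuousOn_dividedDifference hΩ hf
    exact hc.comp (f := fun q : ℝ × E => (q.1, k, a)) (by fun_prop)
      fun q _ => ⟨trivial, trivial, ha⟩
  have hk : ∀ k ∈ σ a, HasFDerivAt
      (fun b => (m (spectralSum m σ P (fun q => dividedDifference f (q.1, k, a)) b)
        (A b - A a))) _ a :=
    fun k _ => hasFDerivAt_clm_apply_of_eq_zero (m.continuous.continuousAt.comp (hT k)) hu
      (sub_self _)
  have hsum := HasFDerivAt.fun_sum fun k hk' =>
    ((m.flip (P a k)).hasFDerivAt.comp a (hk k hk'))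
  refine ((hsum.const_add (spectralSum m σ P (fun q => f (q.1, a)) a)).congr_fderiv
    ?_).congr_of_eventuallyEq ?_
  · rfl
  · filter_upwards [hΩ.mem_nhds ha] with b hb
    rw [← sub_eq_iff_eq_add', h.spectralSum_sub ha hb, Finset.sum_comm]
    refine Finset.sum_congr rfl fun k hk => ?_
    simp only [Function.comp_apply, ContinuousLinearMap.flip_apply, spectralSum, map_sum, sum_apply]
    refine Finset.sum_congr rfl fun l hl => ?_
    rw [sub_eq_smul_dividedDifference hΩ hf ha, map_smul, smul_apply, ← map_smul,
      ← h.mul_sub_mul ha hb hl hk, hm, hm, mul_assoc]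

/-- The derivative of a spectral sum is a sum of two spectral sums with values in `E →L[ℝ] W`; the
coefficients of the second one are themselves spectral sums, over the parameter space `ℝ × E`. -/
theorem hasFDerivAt_spectralSum [CompleteSpace W]
    (hm : ∀ w x y, m (m w x) y = m w (x * y)) (h : SpectralResolutionOn A σ P K C Ω)
    (hΩ : IsOpen Ω) (hA : ContDiffOn ℝ 1 A Ω) (hf : ContDiffOn ℝ 1 f (univ ×ˢ Ω)) (ha : a ∈ Ω) :
    HasFDerivAt (spectralSum m σ P f)
      (spectralSum (actionOnMaps E m) σ P
          (fun q => (fderiv ℝ f q).comp (ContinuousLinearMap.inr ℝ ℝ E)) a +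
        spectralSum (actionOnMaps E m) σ P (fun q =>
          (m (spectralSum m (fun p : ℝ × E => σ p.2) (fun p => P p.2)
            (dividedDifference f) q)).comp (fderiv ℝ A q.2)) a) a := by
  refine ((h.hasFDerivAt_spectralSum_const_spectrum hΩ hA.continuousOn hf ha).add
    (h.hasFDerivAt_spectralSum_const_param hm hΩ hA hf ha)).congr_of_eventuallyEq
    (Eventually.of_forall fun b => ?_)
  simp [spectralSum, Finset.sum_sub_distrib]

end SpectralResolutionOn

/-- Induction on `k`: by `hasFDerivAt_spectralSum`, the derivative of a spectral sum is a sum of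
spectral sums with `C^k` coefficients. The statement is made for all parameter spaces and all
modules at once, since both change in the induction step. -/
theorem contDiffOn_spectralSum {R : Type*} [NormedRing R] [NormedAlgebra ℝ R] {K : ℕ} {C : ℝ}
    (k : ℕ) : ∀ {E W : Type u} [NormedAddCommGroup E] [NormedSpace ℝ E] [FiniteDimensional ℝ E]
      [NormedAddCommGroup W] [NormedSpace ℝ W] [CompleteSpace W] {m : W →L[ℝ] R →L[ℝ] W}
      {A : E → R} {σ : E → Finset ℝ} {P : E → ℝ → R} {Ω : Set E} {f : ℝ × E → W}
      (_ : ∀ w x y, m (m w x) y = m w (x * y)) (_ : SpectralResolutionOn A σ P K C Ω)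
      (_ : IsOpen Ω) (_ : ContDiffOn ℝ k A Ω) (_ : ContDiffOn ℝ k f (univ ×ˢ Ω)),
      ContDiffOn ℝ k (spectralSum m σ P f) Ω := by
  induction k with
  | zero =>
    intro E W _ _ _ _ _ _ m A σ P Ω f hm h hΩ hA hf
    rw [Nat.cast_zero, contDiffOn_zero] at *
    exact h.continuousOn_spectralSum hΩ hA hf
  | succ k ih =>
    intro E W _ _ _ _ _ _ m A σ P Ω f hm h hΩ hA hf
    have hU : IsOpen ((univ : Set ℝ) ×ˢ Ω) := isOpen_univ.prod hΩ
    have hk1 : (1 : WithTop ℕ∞) ≤ ((k + 1 : ℕ) : WithTop ℕ∞) := by norm_cast; omega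
    have hkk : ((k : ℕ) : WithTop ℕ∞) ≤ ((k + 1 : ℕ) : WithTop ℕ∞) := by norm_cast; omega
    have hder := fun a (ha : a ∈ Ω) =>
      h.hasFDerivAt_spectralSum hm hΩ (hA.of_le hk1) (hf.of_le hk1) ha
    have hAk := hA.of_le hkk
    rw [Nat.cast_add, Nat.cast_one] at hA hf ⊢
    have hT := contDiffOn_dividedDifference hΩ hf
    rw [contDiffOn_succ_iff_fderiv_of_isOpen hΩ] at hA ⊢
    rw [contDiffOn_succ_iff_fderiv_of_isOpen hU] at hf
    have hm' : ∀ φ x y, actionOnMaps E m (actionOnMaps E m φ x) y = actionOnMaps E m φ (x * y) :=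
      fun φ x y => ContinuousLinearMap.ext fun v => hm _ _ _
    have hsnd : MapsTo (Prod.snd : ℝ × E → E) (univ ×ˢ Ω) Ω := fun q hq => hq.2
    have hlift : SpectralResolutionOn (fun q : ℝ × E => A q.2) (fun q => σ q.2) (fun q => P q.2)
        K C (univ ×ˢ Ω) :=
      ⟨fun q hq => h.sum_eq_one _ hq.2, fun q hq => h.mul_left _ hq.2,
        fun q hq => h.mul_right _ hq.2, fun q hq => h.norm_le _ hq.2, fun q hq => h.card_le _ hq.2⟩
    have hG := ih hm hlift hU (hAk.comp contDiff_snd.contDiffOn hsnd) hT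
    refine ⟨fun a ha => (hder a ha).differentiableAt.differentiableWithinAt, by simp, ?_⟩
    refine ContDiffOn.congr (ContDiffOn.add ?_ ?_) fun a ha => (hder a ha).fderiv
    · exact ih hm' h hΩ hAk (hf.2.2.clm_comp contDiffOn_const)
    · exact ih hm' h hΩ hAk ((m.contDiff.comp_contDiffOn hG).clm_comp
        (hA.2.2.comp contDiff_snd.contDiffOn hsnd))

/-! ### Functions of class `W^{1,∞}` are uniformly Lipschitz on convex subsets -/

lemma exists_ae_norm_le_of_memLp_top {X F : Type*} [MeasureSpace X] [NormedAddCommGroup F]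
    {f : X → F} {Ω : Set X} (hf : MemLp f ∞ (volume.restrict Ω)) :
    ∃ B : ℝ, 0 ≤ B ∧ ∀ᵐ x ∂(volume.restrict Ω), ‖f x‖ ≤ B := by
  refine ⟨(eLpNormEssSup f (volume.restrict Ω)).toReal, ENNReal.toReal_nonneg, ?_⟩
  have h1 : eLpNormEssSup f (volume.restrict Ω) ≠ ⊤ := by
    have := hf.2.ne
    rwa [eLpNorm_exponent_top] at this
  filter_upwards [ae_le_eLpNormEssSup (f := f) (μ := volume.restrict Ω)] with x hx
  rw [← toReal_enorm]
  exact ENNReal.toReal_mono h1 hx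

lemma exists_norm_le_of_continuousOn_of_memLp_top {X F : Type*} [TopologicalSpace X]
    [MeasureSpace X] [BorelSpace X] [(volume : Measure X).IsOpenPosMeasure] [NormedAddCommGroup F]
    {f : X → F} {Ω : Set X} (hΩ : IsOpen Ω) (hc : ContinuousOn f Ω)
    (hf : MemLp f ∞ (volume.restrict Ω)) : ∃ B : ℝ, 0 ≤ B ∧ ∀ x ∈ Ω, ‖f x‖ ≤ B := by
  obtain ⟨B, hB0, hB⟩ := exists_ae_norm_le_of_memLp_top hf
  refine ⟨B, hB0, fun x hx => ?_⟩
  have hopen : IsOpen (Ω ∩ (fun x => ‖f x‖) ⁻¹' Ioi B) :=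
    hc.norm.isOpen_inter_preimage hΩ isOpen_Ioi
  have hzero : volume (Ω ∩ (fun x => ‖f x‖) ⁻¹' Ioi B) = 0 := by
    rw [ae_restrict_iff' hΩ.measurableSet, ae_iff] at hB
    refine measure_mono_null (fun y hy => ?_) hB
    simpa using hy
  have hempty := hopen.eq_empty_of_measure_zero hzero
  by_contra hlt
  exact (hempty ▸ (⟨hx, not_le.1 hlt⟩ : x ∈ Ω ∩ (fun x => ‖f x‖) ⁻¹' Ioi B) : x ∈ (∅ : Set X))

section Sobolev

variable {X F : Type*} [NormedAddCommGroup X] [NormedSpace ℝ X] [FiniteDimensional ℝ X]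
  [MeasureSpace X] [BorelSpace X] [(volume : Measure X).IsAddHaarMeasure]
  [NormedAddCommGroup F] [NormedSpace ℝ F] {f : X → F} {Ω : Set X}

/-- The mollification by `φ` of the extension of `f` by zero outside `Ω`. -/
noncomputable def mollify (Ω : Set X) (f : X → F) (φ : ContDiffBump (0 : X)) : X → F :=
  convolution (Ω.indicator f) (φ.normed volume) (ContinuousLinearMap.lsmul ℝ ℝ).flip volume

lemma dist_mollify_le [CompleteSpace F] (hΩ : IsOpen Ω) (hc : ContinuousOn f Ω)
    (φ : ContDiffBump (0 : X)) {x : X} (hx : x ∈ Ω) {ε : ℝ}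
    (h : ∀ y ∈ Metric.ball x φ.rOut, y ∈ Ω ∧ dist (f y) (f x) ≤ ε) :
    dist (mollify Ω f φ x) (f x) ≤ ε := by
  rw [mollify, convolution_flip]
  have h1 := ContDiffBump.dist_normed_convolution_le (μ := (volume : Measure X)) (φ := φ)
    (g := Ω.indicator f) (x₀ := x) (ε := ε)
    ((aestronglyMeasurable_indicator_iff hΩ.measurableSet).2
      (hc.aestronglyMeasurable hΩ.measurableSet)) fun y hy => by
        rw [indicator_of_mem hx, indicator_of_mem (h y hy).1]
        exact (h y hy).2
  rwa [indicator_of_mem hx] at h1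

lemma hasCompactSupport_normed_sub (φ : ContDiffBump (0 : X)) (z : X) :
    HasCompactSupport fun t => φ.normed volume (z - t) :=
  φ.hasCompactSupport_normed.comp_homeomorph (Homeomorph.subLeft z)

/-- The derivative of a mollification is the mollified weak gradient, so a bound for the weak
gradient bounds it. -/
lemma norm_fderiv_mollify_le (hΩ : IsOpen Ω) (hf : MemLp f ∞ (volume.restrict Ω))
    {g : X → X →L[ℝ] F} (hg : HasWeakGradientOn f g Ω) {L : ℝ} (hL : 0 ≤ L)
    (hgL : ∀ᵐ x ∂(volume.restrict Ω), ‖g x‖ ≤ L) (φ : ContDiffBump (0 : X)) {z : X}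
    (hz : Metric.closedBall z φ.rOut ⊆ Ω) :
    ∃ D : X →L[ℝ] F, HasFDerivAt (mollify Ω f φ) D z ∧ ‖D‖ ≤ L := by
  have hloc : LocallyIntegrable (Ω.indicator f) volume :=
    ((memLp_indicator_iff_restrict hΩ.measurableSet).2 hf).locallyIntegrable le_top
  have hφ : ContDiff ℝ ∞ (φ.normed (volume : Measure X)) := φ.contDiff_normed
  have hφ1 : ContDiff ℝ 1 (φ.normed (volume : Measure X)) := φ.contDiff_normed
  refine ⟨_, φ.hasCompactSupport_normed.hasFDerivAt_convolution_right _ hloc hφ1 z,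
    ContinuousLinearMap.opNorm_le_bound _ hL fun v => ?_⟩
  rw [convolution_precompR_apply _ hloc (φ.hasCompactSupport_normed.fderiv ℝ)
    (hφ1.continuous_fderiv one_ne_zero), convolution_def]
  set ψ : X → ℝ := fun t => φ.normed volume (z - t) with hψ
  have hψs : ContDiff ℝ ∞ ψ := hφ.comp (contDiff_const.sub contDiff_id)
  have hψc : HasCompactSupport ψ := hasCompactSupport_normed_sub φ z
  have hψsupp : Function.support ψ ⊆ Metric.closedBall z φ.rOut := fun t ht => by
    have : z - t ∈ Function.support (φ.normed (volume : Measure X)) := ht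
    rw [φ.support_normed_eq, mem_ball_zero_iff] at this
    rw [mem_closedBall_iff_norm']
    exact this.le
  have hψΩ : tsupport ψ ⊆ Ω :=
    (closure_minimal hψsupp Metric.isClosed_closedBall).trans hz
  have hψd : ∀ t, fderiv ℝ ψ t v = - fderiv ℝ (φ.normed volume) (z - t) v := fun t => by
    have h1 : HasFDerivAt (φ.normed (volume : Measure X)) _ (z - t) :=
      (hφ1.differentiable one_ne_zero (z - t)).hasFDerivAt
    have h2 : HasFDerivAt ψ _ t := h1.comp t ((hasFDerivAt_id t).const_sub z)
    rw [h2.fderiv]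
    simp
  have hint : ∫ t, ψ t = 1 := by
    rw [hψ, integral_sub_left_eq_self (fun t => φ.normed volume t) volume z, φ.integral_normed]
  have hψ0 : ∀ t, 0 ≤ ψ t := fun t => φ.nonneg_normed _
  have hψi : Integrable ψ := hψs.continuous.integrable_of_hasCompactSupport hψc
  have hweak := hg ψ hψs hψc hψΩ v
  -- The weak gradient is tested on `ψ t = φ (z - t)`; the sign of `∇ψ` cancels that of the
  -- definition.
  have hEq : ∫ t, ((ContinuousLinearMap.lsmul ℝ ℝ).flip (Ω.indicator f t))
      (fderiv ℝ (φ.normed volume) (z - t) v) = ∫ t in Ω, ψ t • g t v := by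
    rw [← neg_eq_iff_eq_neg.2 hweak, ← integral_neg, ← integral_indicator hΩ.measurableSet]
    refine integral_congr_ae (Eventually.of_forall fun t => ?_)
    by_cases ht : t ∈ Ω
    · simp [indicator_of_mem ht, hψd]
    · simp [indicator_of_notMem ht]
  rw [hEq]
  calc ‖∫ t in Ω, ψ t • g t v‖ ≤ ∫ t in Ω, ψ t * (L * ‖v‖) := by
        refine norm_integral_le_of_norm_le (hψi.restrict.mul_const _) ?_
        filter_upwards [hgL] with t ht
        rw [norm_smul, Real.norm_of_nonneg (hψ0 t)]
        exact mul_le_mul_of_nonneg_left ((g t).le_of_opNorm_le ht v) (hψ0 t)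
    _ = (∫ t in Ω, ψ t) * (L * ‖v‖) := integral_mul_const _ _
    _ ≤ (∫ t, ψ t) * (L * ‖v‖) :=
        mul_le_mul_of_nonneg_right (setIntegral_le_integral hψi (Eventually.of_forall hψ0))
          (by positivity)
    _ = L * ‖v‖ := by rw [hint, one_mul]

/-- A function of class `W^{1,∞}` satisfies, with one constant, a Lipschitz estimate between the end
points of every segment contained in the domain. -/
theorem MemW1Infty.exists_norm_sub_le [CompleteSpace F] (hΩ : IsOpen Ω) (hf : MemW1Infty f Ω) :
    ∃ L : ℝ, 0 ≤ L ∧ ∀ x y, segment ℝ x y ⊆ Ω → ‖f y - f x‖ ≤ L * ‖y - x‖ := by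
  obtain ⟨hc, hfm, g, hgm, hg⟩ := hf
  obtain ⟨L, hL, hgL⟩ := exists_ae_norm_le_of_memLp_top hgm
  refine ⟨L, hL, fun x y hxy => ?_⟩
  have hx : x ∈ Ω := hxy (left_mem_segment ℝ x y)
  have hy : y ∈ Ω := hxy (right_mem_segment ℝ x y)
  have hcomp : IsCompact (segment ℝ x y) := by
    rw [segment_eq_image_lineMap]
    exact isCompact_Icc.image (by fun_prop)
  obtain ⟨δ, hδ, hδΩ⟩ := hcomp.exists_cthickening_subset_open hΩ hxy
  refine le_of_forall_pos_le_add fun ε hε => ?_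
  obtain ⟨r, hr, hrx⟩ := Metric.continuousAt_iff.1 (hc.continuousAt (hΩ.mem_nhds hx)) (ε / 2)
    (by positivity)
  obtain ⟨s, hs, hsy⟩ := Metric.continuousAt_iff.1 (hc.continuousAt (hΩ.mem_nhds hy)) (ε / 2)
    (by positivity)
  have hρ : 0 < min δ (min r s) := lt_min hδ (lt_min hr hs)
  let φ : ContDiffBump (0 : X) := ⟨min δ (min r s) / 2, min δ (min r s), by positivity, by linarith⟩
  have hball : ∀ z ∈ segment ℝ x y, Metric.closedBall z φ.rOut ⊆ Ω := fun z hz w hw =>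
    hδΩ (Metric.mem_cthickening_of_dist_le w z δ _ hz
      ((Metric.mem_closedBall.1 hw).trans (min_le_left _ _)))
  have hmx : dist (mollify Ω f φ x) (f x) ≤ ε / 2 := dist_mollify_le hΩ hc φ hx fun w hw =>
    ⟨hball x (left_mem_segment ℝ x y) (Metric.ball_subset_closedBall hw),
      (hrx ((Metric.mem_ball.1 hw).trans_le ((min_le_right _ _).trans (min_le_left _ _)))).le⟩
  have hmy : dist (mollify Ω f φ y) (f y) ≤ ε / 2 := dist_mollify_le hΩ hc φ hy fun w hw =>
    ⟨hball y (right_mem_segment ℝ x y) (Metric.ball_subset_closedBall hw),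
      (hsy ((Metric.mem_ball.1 hw).trans_le ((min_le_right _ _).trans (min_le_right _ _)))).le⟩
  choose! D hD hDL using fun z hz => norm_fderiv_mollify_le hΩ hfm hg hL hgL φ (hball z hz)
  have hm := (convex_segment x y).norm_image_sub_le_of_norm_hasFDerivWithin_le
    (fun z hz => (hD z hz).hasFDerivWithinAt) hDL (left_mem_segment ℝ x y)
    (right_mem_segment ℝ x y)
  rw [dist_eq_norm] at hmx hmy
  rw [norm_sub_rev] at hmy
  calc ‖f y - f x‖ = ‖(f y - mollify Ω f φ y) + (mollify Ω f φ y - mollify Ω f φ x) +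
        (mollify Ω f φ x - f x)‖ := by congr 1; abel
    _ ≤ ε / 2 + L * ‖y - x‖ + ε / 2 := norm_add₃_le.trans (by gcongr)
    _ = L * ‖y - x‖ + ε := by ring

/-! ### Bounded uniformly locally Lipschitz functions are of class `W^{1,∞}` -/

variable [FiniteDimensional ℝ F]

/-- Integration by parts against a Lipschitz function with values in a finite-dimensional space. -/
lemma integral_fderiv_smul_eq_neg {C : NNReal} (hf : LipschitzWith C f) {φ : X → ℝ}
    (hφ : ContDiff ℝ ∞ φ) (hφc : HasCompactSupport φ) (v : X) :
    ∫ x, fderiv ℝ φ x v • f x = - ∫ x, φ x • fderiv ℝ f x v := by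
  have : CompleteSpace F := FiniteDimensional.complete ℝ F
  have : SecondCountableTopology F := by
    have := FiniteDimensional.proper ℝ F
    infer_instance
  have hφ' : Continuous fun x => fderiv ℝ φ x v :=
    (hφ.continuous_fderiv (by simp)).clm_apply continuous_const
  have hφ'c : HasCompactSupport fun x => fderiv ℝ φ x v :=
    (hφc.fderiv ℝ).comp_left (g := fun T : X →L[ℝ] ℝ => T v) rfl
  obtain ⟨C', hC'⟩ := hφ.lipschitzWith_of_hasCompactSupport hφc (by simp)
  have hi1 : Integrable fun x => fderiv ℝ φ x v • f x :=
    (hφ'.smul hf.continuous).integrable_of_hasCompactSupport hφ'c.smul_right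
  have hi2 : Integrable fun x => φ x • fderiv ℝ f x v := by
    refine (hφ.continuous.integrable_of_hasCompactSupport hφc).smul_bdd (C * ‖v‖)
      ?_ (Eventually.of_forall fun x => ?_)
    · borelize F
      exact (measurable_fderiv_apply_const ℝ f v).aestronglyMeasurable
    · exact (fderiv ℝ f x).le_of_opNorm_le (norm_fderiv_le_of_lipschitz ℝ hf) v
  refine (SeparatingDual.eq_iff_forall_dual_eq (R := ℝ)).2 fun ℓ => ?_
  rw [map_neg, ← ℓ.integral_comp_comm hi1, ← ℓ.integral_comp_comm hi2, ← integral_neg]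
  have h := (ℓ.lipschitz.comp hf).integral_lineDeriv_mul_eq (μ := volume) hC' hφc v
  have h1 : ∀ x, lineDeriv ℝ φ x (-v) = - fderiv ℝ φ x v := fun x => by
    rw [(hφ.differentiable (by simp) x).lineDeriv_eq_fderiv, map_neg]
  have h2 : ∀ᵐ x, lineDeriv ℝ (ℓ ∘ f) x v = ℓ (fderiv ℝ f x v) := by
    filter_upwards [hf.ae_differentiableAt (μ := volume)] with x hx
    have h3 : HasFDerivAt (ℓ ∘ f) _ x := ℓ.hasFDerivAt.comp x hx.hasFDerivAt
    rw [h3.differentiableAt.lineDeriv_eq_fderiv, h3.fderiv]; rfl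
  simp only [h1, neg_mul, integral_neg, Function.comp_apply] at h
  simp only [map_smul, smul_eq_mul, integral_neg]
  rw [← neg_eq_iff_eq_neg, ← h]
  refine integral_congr_ae ?_
  filter_upwards [h2] with x hx
  rw [hx, mul_comm]

/-- The weak gradient of a locally Lipschitz function is its almost everywhere derivative. -/
lemma hasWeakGradientOn_fderiv (hΩ : IsOpen Ω) (hf : LocallyLipschitzOn Ω f) :
    HasWeakGradientOn f (fderiv ℝ f) Ω := by
  intro φ hφ hφc hφΩ v
  have : ProperSpace X := FiniteDimensional.proper ℝ X
  obtain ⟨δ, hδ, hδΩ⟩ := hφc.isCompact.exists_cthickening_subset_open hΩ hφΩ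
  obtain ⟨C, hC⟩ := (hf.mono hδΩ).exists_lipschitzOnWith_of_compact hφc.isCompact.cthickening
  -- A globally Lipschitz function that agrees with `f` on a neighbourhood of the support of `φ`.
  obtain ⟨F', hF', hfF'⟩ := hC.extend_finite_dimension
  have hnhds : ∀ x ∈ tsupport φ, f =ᶠ[𝓝 x] F' := fun x hx => by
    filter_upwards [Metric.isOpen_thickening.mem_nhds (Metric.self_subset_thickening hδ _ hx)]
      with y hy using hfF' (Metric.thickening_subset_cthickening _ _ hy)
  have h1 : ∀ x, fderiv ℝ φ x v • f x = fderiv ℝ φ x v • F' x := fun x => by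
    by_cases hx : x ∈ tsupport φ
    · rw [(hnhds x hx).eq_of_nhds]
    · rw [fderiv_of_notMem_tsupport ℝ hx]; simp
  have h2 : ∀ x, φ x • fderiv ℝ f x v = φ x • fderiv ℝ F' x v := fun x => by
    by_cases hx : x ∈ tsupport φ
    · rw [(hnhds x hx).fderiv_eq]
    · rw [image_eq_zero_of_notMem_tsupport hx]; simp
  rw [setIntegral_eq_integral_of_forall_compl_eq_zero fun x hx => by
      rw [fderiv_of_notMem_tsupport ℝ fun h => hx (hφΩ h)]; simp,
    setIntegral_eq_integral_of_forall_compl_eq_zero fun x hx => by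
      rw [image_eq_zero_of_notMem_tsupport fun h => hx (hφΩ h)]; simp]
  simp only [h1, h2]
  exact integral_fderiv_smul_eq_neg hF' hφ hφc v

theorem memW1Infty_of_lipschitzOnWith_ball (hΩ : IsOpen Ω) {B : ℝ} (hB : ∀ x ∈ Ω, ‖f x‖ ≤ B)
    {L : NNReal} (hL : ∀ x r, Metric.ball x r ⊆ Ω → LipschitzOnWith L f (Metric.ball x r)) :
    MemW1Infty f Ω := by
  have : CompleteSpace F := FiniteDimensional.complete ℝ F
  have hball : ∀ x ∈ Ω, ∃ t ∈ 𝓝 x, LipschitzOnWith L f t := fun x hx => by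
    obtain ⟨r, hr, hrΩ⟩ := Metric.isOpen_iff.1 hΩ x hx
    exact ⟨_, Metric.ball_mem_nhds x hr, hL x r hrΩ⟩
  have hloc : LocallyLipschitzOn Ω f := fun x hx => by
    obtain ⟨t, ht, htL⟩ := hball x hx
    exact ⟨L, t, mem_nhdsWithin_of_mem_nhds ht, htL⟩
  have hc := hloc.continuousOn
  refine ⟨hc, memLp_top_of_bound (hc.aestronglyMeasurable hΩ.measurableSet) B
    ((ae_restrict_iff' hΩ.measurableSet).2 (Eventually.of_forall hB)), fderiv ℝ f,
    memLp_top_of_bound (measurable_fderiv ℝ f).aestronglyMeasurable L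
    ((ae_restrict_iff' hΩ.measurableSet).2 (Eventually.of_forall fun x hx => ?_)),
    hasWeakGradientOn_fderiv hΩ hloc⟩
  obtain ⟨t, ht, htL⟩ := hball x hx
  exact norm_fderiv_le_of_lipschitzOn ℝ ht htL

end Sobolev

/-! ### The functional calculus of a uniformly strongly hyperbolic family -/

theorem SpectralResolutionOn.memW1Infty_spectralSum {n : ℕ} {R W : Type*}
    [NormedRing R] [NormedAlgebra ℝ R] [CompleteSpace R] [NormedAddCommGroup W] [NormedSpace ℝ W]
    [FiniteDimensional ℝ W] {m : W →L[ℝ] R →L[ℝ] W} {A : EuclideanSpace ℝ (Fin n) → R}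
    {σ : EuclideanSpace ℝ (Fin n) → Finset ℝ} {P : EuclideanSpace ℝ (Fin n) → ℝ → R} {K : ℕ}
    {C : ℝ} {Ω : Set (EuclideanSpace ℝ (Fin n))} {f : ℝ × EuclideanSpace ℝ (Fin n) → W}
    (h : SpectralResolutionOn A σ P K C Ω) (hC : 0 ≤ C) (hΩ : IsOpen Ω) (hA : MemW1Infty A Ω)
    (hf : MemW1Infty f (univ ×ˢ Ω)) : MemW1Infty (spectralSum m σ P f) Ω := by
  have : CompleteSpace W := FiniteDimensional.complete ℝ W
  -- The volume of a product is the product measure only up to unfolding, which instance search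
  -- does not see.
  have hvol : (volume : Measure (ℝ × EuclideanSpace ℝ (Fin n))).IsAddHaarMeasure := by
    rw [Measure.volume_eq_prod]; infer_instance
  have hU : IsOpen ((univ : Set ℝ) ×ˢ Ω) := isOpen_univ.prod hΩ
  obtain ⟨B, hB0, hB⟩ := exists_norm_le_of_continuousOn_of_memLp_top hU hf.1 hf.2.1
  obtain ⟨LA, hLA0, hLA⟩ := hA.exists_norm_sub_le hΩ
  obtain ⟨Lf, hLf0, hLf⟩ := hf.exists_norm_sub_le hU
  have hL0 : 0 ≤ (K : ℝ) ^ 2 * (‖m‖ * C ^ 2 * (Lf * (1 + LA))) := by positivity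
  refine memW1Infty_of_lipschitzOnWith_ball hΩ
    (fun x hx => h.norm_spectralSum_le hx hB0 hC fun l => hB (l, x) ⟨trivial, hx⟩)
    (L := NNReal.mk _ hL0) fun x r hr => LipschitzOnWith.of_dist_le_mul fun b hb a ha => ?_
  rw [dist_eq_norm, dist_eq_norm, NNReal.coe_mk]
  have hab : segment ℝ a b ⊆ Ω := ((convex_ball x r).segment_subset ha hb).trans hr
  have hmain := h.norm_spectralSum_sub_le (m := m) (f := f) (hr ha) (hr hb)
    (ε := Lf * ‖b - a‖) (L := Lf) (by positivity) hLf0 fun l _ _ k _ => by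
      have hseg : segment ℝ (k, a) (l, b) ⊆ univ ×ˢ Ω :=
        (Convex.segment_subset (convex_univ.prod (convex_segment a b))
          ⟨trivial, left_mem_segment ℝ a b⟩ ⟨trivial, right_mem_segment ℝ a b⟩).trans
          (prod_mono subset_rfl hab)
      refine (hLf _ _ hseg).trans ?_
      rw [← mul_add, Prod.norm_def, Prod.fst_sub, Prod.snd_sub, Real.norm_eq_abs]
      refine mul_le_mul_of_nonneg_left (max_le ?_ ?_) hLf0
      · exact le_add_of_nonneg_left (norm_nonneg _)
      · exact le_add_of_nonneg_right (abs_nonneg _)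
  refine hmain.trans ?_
  calc (K : ℝ) ^ 2 * (‖m‖ * C ^ 2 * (Lf * ‖b - a‖ + Lf * ‖A b - A a‖))
      ≤ (K : ℝ) ^ 2 * (‖m‖ * C ^ 2 * (Lf * ‖b - a‖ + Lf * (LA * ‖b - a‖))) := by
        gcongr; exact hLA a b hab
    _ = _ := by ring

/-- Matrix multiplication as a bounded bilinear map over `ℝ`. -/
noncomputable def matrixMul (M N : ℕ) : Matrix (Fin M) (Fin N) ℂ →L[ℝ]
    Matrix (Fin N) (Fin N) ℂ →L[ℝ] Matrix (Fin M) (Fin N) ℂ :=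
  (LinearMap.mk₂ ℝ (fun S B => S * B) (fun S T B => Matrix.add_mul S T B)
    (fun c S B => Matrix.smul_mul c S B) (fun S B B' => Matrix.mul_add S B B')
    (fun c S B => Matrix.mul_smul S c B)).mkContinuous₂ 1 fun S B => by
      rw [one_mul]; exact Matrix.l2_opNorm_mul S B

end StrongHyp

theorem mainTheorem9 (n N M : ℕ) (Ω : Set (EuclideanSpace ℝ (Fin n))) (hΩ : IsOpen Ω)
    (A : EuclideanSpace ℝ (Fin n) → Matrix (Fin N) (Fin N) ℂ)
    (hA : StrongHyp.UniformlyStronglyHyperbolicOn A Ω)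
    (S : ℝ × EuclideanSpace ℝ (Fin n) → Matrix (Fin M) (Fin N) ℂ) :
    (ContinuousOn A Ω → ContinuousOn S (Set.univ ×ˢ Ω) →
      ContinuousOn (StrongHyp.functionalCalculus A S) Ω) ∧
    (StrongHyp.MemW1Infty A Ω → StrongHyp.MemW1Infty S (Set.univ ×ˢ Ω) →
      StrongHyp.MemW1Infty (StrongHyp.functionalCalculus A S) Ω) ∧
    (ContDiffOn ℝ ∞ A Ω → ContDiffOn ℝ ∞ S (Set.univ ×ˢ Ω) →
      ContDiffOn ℝ ∞ (StrongHyp.functionalCalculus A S) Ω) := by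
  obtain ⟨C, hC0, h⟩ := hA.exists_spectralResolutionOn
  have hS : StrongHyp.functionalCalculus A S =
      StrongHyp.spectralSum (StrongHyp.matrixMul M N)
        (fun a => (Matrix.finite_real_spectrum (A := A a)).toFinset)
        (fun a l => StrongHyp.eigenprojector (A a) (l : ℂ)) S := rfl
  have hm : ∀ w x y, StrongHyp.matrixMul M N (StrongHyp.matrixMul M N w x) y =
      StrongHyp.matrixMul M N w (x * y) := fun w x y => Matrix.mul_assoc w x y
  have : FiniteDimensional ℝ (Matrix (Fin M) (Fin N) ℂ) :=
    inferInstanceAs (Module.Finite ℝ (Fin M → Fin N → ℂ))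
  have : CompleteSpace (Matrix (Fin M) (Fin N) ℂ) := FiniteDimensional.complete ℝ _
  rw [hS]
  refine ⟨fun hA hf => h.continuousOn_spectralSum hΩ hA hf,
    fun hA hf => h.memW1Infty_spectralSum hC0 hΩ hA hf, fun hA hf => ?_⟩
  rw [contDiffOn_infty] at hA hf ⊢
  exact fun k => StrongHyp.contDiffOn_spectralSum k hm h hΩ (hA k) (hf k)
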